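/- Let $n\ge 0$ and $d\ge 2$ be integers, let $S=\mathbb C[x_0,\dots,x_n]=\bigoplus_m S_m$ with the standard grading, let $f\in S_d$ be a homogeneous polynomial of degree $d$, and let $V(f)\colon f=0$ be the hypersurface it defines in $\mathbb P^n(\mathbb C)$. A singular point of $V(f)$ is a point of $V(f)$ at which all partial derivatives of $f$ vanish; $V(f)$ is smooth if it has no singular point, and has isolated singularities if it has only finitely many singular points. Let $J_f\subset S$ be the ideal generated by the partial derivatives $\partial f/\partial x_0,\dots,\partial f/\partial x_n$, let $M(f)=S/J_f$ be the Milnor algebra, let $\mathrm{Hess}(f)=(\partial^2 f/\partial x_i\partial x_j)_{0\le i,j\le n}$ and $h(f)=\det \mathrm{Hess}(f)$, and for $1\le k\le n+1$ let $h_k(f)\subset S$ be the ideal generated by all $k\times k$ minors of $\mathrm{Hess}(f)$ and $H_k(f)=S/(J_f+h_k(f))$; in particular $H_{n+1}(f)=S/(J_f+(h(f)))$. For a graded quotient $A=\bigoplus_m A_m$ of $S$ put $HP(A;t)=\sum_{m\ge 0}\dim_{\mathbb C}(A_m)\,t^m$. (i) If $V(f)$ is smooth, then $$HP(H_{n+1}(f);t)=HP(M(f);t)-t^{(n+1)(d-2)}=\frac{(1-t^{d-1})^{n+1}}{(1-t)^{n+1}}-t^{(n+1)(d-2)}.$$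 (ii) If $V(f)$ has isolated singularities and is not smooth, then $h(f)\in J_f$, and hence $$HP(H_{n+1}(f);t)=HP(M(f);t).$$ -/

import Mathlib

noncomputable section

namespace HessianAlgebra

/-- The graded polynomial ring `S = ℂ[x₀, …, xₙ]`. -/
abbrev S (n : ℕ) : Type := MvPolynomial (Fin (n + 1)) ℂ

/-- The Jacobian ideal `J_f`, generated by the partial derivatives of `f`. -/
def jacobianIdeal {n : ℕ} (f : S n) : Ideal (S n) :=
  Ideal.span (Set.range fun j : Fin (n + 1) => MvPolynomial.pderiv j f)

/-- The Hessian matrix `Hess(f)` of second order partial derivatives of `f`. -/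
def hessianMatrix {n : ℕ} (f : S n) : Matrix (Fin (n + 1)) (Fin (n + 1)) (S n) :=
  Matrix.of fun i j => MvPolynomial.pderiv i (MvPolynomial.pderiv j f)

/-- The Hessian `h(f)`, the determinant of the Hessian matrix. -/
def hessian {n : ℕ} (f : S n) : S n := (hessianMatrix f).det

/-- The ideal `h_k(f)` generated by all `k × k` minors of the Hessian matrix. A minor is given by
an increasing choice of `k` rows and an increasing choice of `k` columns. -/
def hessianMinorIdeal {n : ℕ} (k : ℕ) (f : S n) : Ideal (S n) :=
  Ideal.span (Set.range fun rc : (Fin k ↪o Fin (n + 1)) × (Fin k ↪o Fin (n + 1)) =>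
    ((hessianMatrix f).submatrix rc.1 rc.2).det)

/-- The degree `m` component `(S / I)_m` of the quotient by an ideal `I`: the classes of the
homogeneous polynomials of degree `m`. (For a homogeneous ideal `I` this is the standard
grading of `S / I`.) -/
def gradedPiece {n : ℕ} (I : Ideal (S n)) (m : ℕ) : Submodule ℂ (S n ⧸ I) :=
  (MvPolynomial.homogeneousSubmodule (Fin (n + 1)) ℂ m).map (Ideal.Quotient.mkₐ ℂ I).toLinearMap

/-- The Hilbert series `∑ dim (S / I)_m t^m` of the quotient `S / I`. -/
def hilbertSeries {n : ℕ} (I : Ideal (S n)) : PowerSeries ℚ :=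
  PowerSeries.mk fun m => (Module.finrank ℂ (gradedPiece I m) : ℚ)

/-- The Hilbert series `HP(M(f); t)` of the Milnor algebra `M(f) = S / J_f`. -/
def HPMilnor {n : ℕ} (f : S n) : PowerSeries ℚ := hilbertSeries (jacobianIdeal f)

/-- The Hilbert series `HP(H_k(f); t)` of the `k`-th Hessian algebra
`H_k(f) = S / (J_f + h_k(f))`. -/
def HPHessian {n : ℕ} (k : ℕ) (f : S n) : PowerSeries ℚ :=
  hilbertSeries (jacobianIdeal f ⊔ hessianMinorIdeal k f)

/-- The set of singular points of the hypersurface `V(f) : f = 0` in `ℙⁿ(ℂ)`, for `f` homogeneous: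
the points at which `f` and all its partial derivatives vanish. (For homogeneous `f` these
conditions do not depend on the representative of the point.) -/
def singularPoints {n : ℕ} (f : S n) : Set (Projectivization ℂ (Fin (n + 1) → ℂ)) :=
  {a | MvPolynomial.eval a.rep f = 0 ∧
    ∀ j : Fin (n + 1), MvPolynomial.eval a.rep (MvPolynomial.pderiv j f) = 0}

/-- The hypersurface `V(f)` is smooth: it has no singular point. -/
def IsSmooth {n : ℕ} (f : S n) : Prop := singularPoints f = ∅

/-- The hypersurface `V(f)` has (at most) isolated singularities: the singular points, which form a
closed subvariety of `ℙⁿ`, are finite in number. -/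
def HasIsolatedSingularities {n : ℕ} (f : S n) : Prop := (singularPoints f).Finite

end HessianAlgebra

end

/-! By Euler's relation the transposed Hessian matrix A satisfies A·x = (d−1)∇f. The central fact is
that if A·x = g, the class of det A modulo (g) depends only on g (`det_sub_det_mem`). Exchanging
rows one at a time reduces this to a matrix one of whose rows is a syzygy of the variables; such a
row is a Koszul syzygy, and skew-symmetry kills the determinant modulo (g).

If V(f) is singular, the partials have a common zero in projective space, and A can be exchanged for
a matrix with that point in its kernel, of determinant 0; hence h ∈ J. If V(f) is smooth, the
Nullstellensatz puts powers of all variables in J, and comparison with a diagonal matrix of powers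
gives h ∉ J (`det_notMem_span`).

In the smooth case the Hilbert series of M(f) is found by deforming the partials to x_i^e, e = d−1.
The complete intersection series forces each generator to be a nonzerodivisor modulo the others, so
the series survives the exchange of one generator as long as the ideal still contains a power of
(x_0,…,x_n) (`HasCIHilbertSeries.update`). That condition is open, so a general member of the pencil
joins the two families. The series is then (1+…+t^(d−2))^(n+1), monic of degree T = (n+1)(d−2) = deg
h. Thus M(f)_T is the line spanned by h, and dividing by h removes exactly t^T. -/

open MvPolynomial

/-! ### Koszul syzygies of the variables -/

section Syzygies

variable {σ K : Type*} [Field K]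

theorem homogeneousComponent_succ_X_mul (m : ℕ) (k : σ) (p : MvPolynomial σ K) :
    homogeneousComponent (m + 1) (X k * p) = X k * homogeneousComponent m p := by
  classical
  ext d
  rw [coeff_homogeneousComponent, coeff_X_mul', coeff_X_mul', coeff_homogeneousComponent]
  by_cases hk : k ∈ d.support
  · have hd : d = Finsupp.single k 1 + (d - Finsupp.single k 1) := by
      rw [add_tsub_cancel_of_le]
      simpa [Finsupp.single_le_iff, Nat.one_le_iff_ne_zero] using hk
    have : d.degree = m + 1 ↔ (d - Finsupp.single k 1).degree = m := by
      conv_lhs => rw [hd]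
      simp [add_comm 1]
    simp [hk, this]
  · simp [hk]

theorem sum_range_homogeneousComponent {N : ℕ} {p : MvPolynomial σ K} (hN : p.totalDegree < N) :
    ∑ m ∈ Finset.range N, homogeneousComponent m p = p := by
  conv_rhs => rw [← sum_homogeneousComponent p]
  symm
  apply Finset.sum_subset
  · intro m hm
    simp only [Finset.mem_range] at hm ⊢
    omega
  · intro m _ hm
    apply homogeneousComponent_eq_zero
    simpa using hm

variable [Fintype σ]

/-- A homogeneous syzygy of the variables is a Koszul syzygy. -/
theorem IsHomogeneous.koszul_of_sum_X_mul_eq_zero {m : ℕ} {b : σ → MvPolynomial σ K}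
    (hb : ∀ k, (b k).IsHomogeneous m) (h : ∑ k, X k * b k = 0) (j : σ) :
    ∑ k, X k * (pderiv k (b j) - pderiv j (b k)) = (m + 1 : ℕ) • b j := by
  classical
  -- Differentiating the relation gives b_j + ∑ x_k ∂_j b_k = 0; Euler gives ∑ x_k ∂_k b_j = m b_j.
  have h1 := congrArg (pderiv j) h
  simp only [map_sum, Derivation.leibniz, pderiv_X, map_zero, smul_eq_mul,
    Finset.sum_add_distrib, Pi.single_apply] at h1
  simp only [mul_ite, mul_one, mul_zero, Finset.sum_ite_eq',
    Finset.mem_univ, if_true] at h1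
  simp only [mul_sub, Finset.sum_sub_distrib, (hb j).sum_X_mul_pderiv]
  rw [add_smul, one_smul]
  linear_combination -h1

/-- Every syzygy of the variables is a Koszul syzygy. -/
theorem exists_koszul_of_sum_X_mul_eq_zero [CharZero K] {b : σ → MvPolynomial σ K}
    (h : ∑ k, X k * b k = 0) :
    ∃ c : σ → σ → MvPolynomial σ K, (∀ j k, c j k = -c k j) ∧ ∀ j, b j = ∑ k, X k * c k j := by
  obtain ⟨N, hN⟩ : ∃ N, ∀ k, (b k).totalDegree < N :=
    ⟨(∑ k, (b k).totalDegree) + 1, fun k => Nat.lt_succ_of_le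
      (Finset.single_le_sum (f := fun k => (b k).totalDegree) (fun _ _ => Nat.zero_le _)
        (Finset.mem_univ k))⟩
  -- The homogeneous identity is inverted degree by degree, whence the factors 1/(m+1).
  refine ⟨fun k j => ∑ m ∈ Finset.range N, C ((m + 1 : ℕ) : K)⁻¹ *
    (pderiv k (homogeneousComponent m (b j)) - pderiv j (homogeneousComponent m (b k))), ?_, ?_⟩
  · intro j k
    rw [← Finset.sum_neg_distrib]
    exact Finset.sum_congr rfl fun m _ => by ring
  · intro j
    conv_lhs => rw [← sum_range_homogeneousComponent (hN j)]
    simp only [Finset.mul_sum]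
    rw [Finset.sum_comm]
    refine Finset.sum_congr rfl fun m _ => ?_
    have hm : ∑ k, X k * homogeneousComponent m (b k) = 0 := by
      have := congrArg (homogeneousComponent (m + 1)) h
      simpa only [map_sum, homogeneousComponent_succ_X_mul, map_zero] using this
    have h2 := IsHomogeneous.koszul_of_sum_X_mul_eq_zero
      (fun k => homogeneousComponent_isHomogeneous m (b k)) hm j
    have h3 : (C ((m + 1 : ℕ) : K)⁻¹ : MvPolynomial σ K) * C ((m + 1 : ℕ) : K) = 1 := by
      rw [← C_mul, inv_mul_cancel₀ (by exact_mod_cast Nat.succ_ne_zero m), C_1]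
    calc homogeneousComponent m (b j)
        = C ((m + 1 : ℕ) : K)⁻¹ * ((m + 1 : ℕ) • homogeneousComponent m (b j)) := by
          rw [nsmul_eq_mul, ← mul_assoc, ← map_natCast (C : K →+* MvPolynomial σ K), h3, one_mul]
      _ = _ := by
          rw [← h2, Finset.mul_sum]
          exact Finset.sum_congr rfl fun k _ => by ring

end Syzygies

/-! ### Determinants with a Koszul row -/

section Determinants

variable {ι R : Type*} [Fintype ι] [DecidableEq ι] [CommRing R]

theorem adjugate_updateRow_apply_self (M : Matrix ι ι R) (r k : ι) (v : ι → R) :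
    (M.updateRow r v).adjugate k r = M.adjugate k r := by
  simp [Matrix.adjugate_apply]

/-- Column r of the adjugate does not see row r, so that row may be replaced by the unit vector e_j.
The new matrix N sends x to x_j e_r and has determinant adj(M)_{jr}; applying adj N to N x gives the
relation. -/
theorem mul_adjugate_eq_mul_adjugate_of_mulVec {M : Matrix ι ι R} {x : ι → R} {r : ι}
    (h : ∀ i, i ≠ r → M.mulVec x i = 0) (j k : ι) :
    x k * M.adjugate j r = x j * M.adjugate k r := by
  set N := M.updateRow r (Pi.single j 1) with hN
  have hNx : N.mulVec x = Pi.single r (x j) := by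
    funext i
    by_cases hi : i = r
    · subst hi
      simp [hN, Matrix.mulVec]
    · have := h i hi
      simp only [Matrix.mulVec] at this ⊢
      have e : N i = M i := by rw [hN, Matrix.updateRow_ne hi]
      rw [show (fun j => N i j) = M i from e]
      simpa [hi] using this
  have h1 : N.adjugate.mulVec (N.mulVec x) = N.det • x := by
    rw [Matrix.mulVec_mulVec, Matrix.adjugate_mul, Matrix.smul_mulVec, Matrix.one_mulVec]
  have h2 := congrFun h1 k
  rw [hNx, Matrix.mulVec_single] at h2
  have h3 : N.adjugate k r = M.adjugate k r := adjugate_updateRow_apply_self M r k _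
  have h4 : N.det = M.adjugate j r := by rw [Matrix.adjugate_apply]
  simp only [Pi.smul_apply, Matrix.col_apply, h3, h4, smul_eq_mul,
    MulOpposite.smul_eq_mul_unop, MulOpposite.unop_op] at h2
  linear_combination -h2

/-- Expansion along row r pairs the skew array c_{kj} with x_k adj(M)_{jr}, which is symmetric in j
and k by the preceding lemma; hence det = −det. -/
theorem two_mul_det_eq_zero_of_koszul {M : Matrix ι ι R} {x : ι → R} {r : ι}
    (h : ∀ i, i ≠ r → M.mulVec x i = 0) {c : ι → ι → R} (hc : ∀ j k, c j k = -c k j)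
    (hr : ∀ j, M r j = ∑ k, x k * c k j) : 2 * M.det = 0 := by
  have h1 : M.det = ∑ j, ∑ k, x k * c k j * M.adjugate j r := by
    have := congrFun (congrFun (Matrix.mul_adjugate M) r) r
    rw [Matrix.mul_apply] at this
    simp only [Matrix.smul_apply, Matrix.one_apply_eq, smul_eq_mul, mul_one] at this
    rw [← this]
    refine Finset.sum_congr rfl fun j _ => ?_
    rw [hr, Finset.sum_mul]
  have h2 : M.det = -∑ j, ∑ k, x k * c k j * M.adjugate j r := by
    rw [h1]
    conv_lhs => rw [Finset.sum_comm]
    rw [← Finset.sum_neg_distrib]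
    refine Finset.sum_congr rfl fun j _ => ?_
    rw [← Finset.sum_neg_distrib]
    refine Finset.sum_congr rfl fun k _ => ?_
    rw [hc j k]
    linear_combination (-c k j) * mul_adjugate_eq_mul_adjugate_of_mulVec h k j
  rw [two_mul]
  nth_rw 2 [h2]
  rw [← h1, add_neg_cancel]

end Determinants

/-! ### Independence of the determinant from the matrix -/

section Independence

variable {σ K : Type*} [Fintype σ] [DecidableEq σ] [Field K] [CharZero K]

/-- Row r is an exact syzygy, so its Koszul form is found in the polynomial ring and only then
reduced modulo I, where the other rows also annihilate the variables. -/
theorem det_mem_of_row_syzygy {M : Matrix σ σ (MvPolynomial σ K)} {r : σ}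
    {I : Ideal (MvPolynomial σ K)} (hI : ∀ i, i ≠ r → M.mulVec X i ∈ I)
    (hr : M.mulVec X r = 0) : M.det ∈ I := by
  obtain ⟨c, hc, hb⟩ := exists_koszul_of_sum_X_mul_eq_zero (b := M r) (by
    rw [← hr, Matrix.mulVec, dotProduct]
    exact Finset.sum_congr rfl fun k _ => mul_comm _ _)
  let q := Ideal.Quotient.mk I
  have h := two_mul_det_eq_zero_of_koszul (M := M.map q) (x := fun k => q (X k)) (r := r)
    (c := fun j k => q (c j k)) ?_ ?_ ?_
  · have h2 : (2 : MvPolynomial σ K) * M.det ∈ I := by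
      rw [← Ideal.Quotient.eq_zero_iff_mem, map_mul, map_ofNat, RingHom.map_det]
      exact h
    have h3 := I.mul_mem_left (C (2⁻¹ : K)) h2
    rwa [← mul_assoc, ← map_ofNat (C : K →+* MvPolynomial σ K) 2, ← C_mul,
      inv_mul_cancel₀ two_ne_zero, C_1, one_mul] at h3
  · intro i hi
    have := Ideal.Quotient.eq_zero_iff_mem.mpr (hI i hi)
    rw [← this]
    simp [Matrix.mulVec, dotProduct, q]
  · intro j k
    rw [hc, map_neg]
  · intro j
    simp [hb, q]

/-- The determinant of a matrix expressing `g` through the variables is independent of the matrix,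
modulo the ideal of `g`. -/
theorem det_sub_det_mem {A B : Matrix σ σ (MvPolynomial σ K)}
    {I : Ideal (MvPolynomial σ K)} (hAB : A.mulVec X = B.mulVec X)
    (hI : ∀ i, A.mulVec X i ∈ I) : A.det - B.det ∈ I := by
  -- Interpolates between B and A: rows in s come from A, the others from B.
  let M : Finset σ → Matrix σ σ (MvPolynomial σ K) := fun s i => if i ∈ s then A i else B i
  have hM : ∀ s i, (M s).mulVec X i = A.mulVec X i := by
    intro s i
    by_cases hi : i ∈ s
    · simp [Matrix.mulVec, M, hi]
    · rw [hAB]; simp [Matrix.mulVec, M, hi]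
  have key : ∀ s, (M s).det - B.det ∈ I := by
    intro s
    induction s using Finset.induction_on with
    | empty =>
      have : M ∅ = B := by funext i; simp [M]
      simp [this]
    | insert r s hr ih =>
      have e1 : M (insert r s) = (M s).updateRow r (B r + (A r - B r)) := by
        funext i
        by_cases hi : i = r
        · subst hi; rw [Matrix.updateRow_self]; simp [M]
        · rw [Matrix.updateRow_ne hi]; simp [M, hi]
      have e2 : (M s).updateRow r (B r) = M s := by
        funext i
        by_cases hi : i = r
        · subst hi; rw [Matrix.updateRow_self]; simp [M, hr]
        · rw [Matrix.updateRow_ne hi]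
      -- By linearity in row r, the determinant changes by that of a matrix with row A_r − B_r, a
      -- syzygy of the variables.
      rw [e1, Matrix.det_updateRow_add, e2, add_sub_right_comm]
      refine I.add_mem ih (det_mem_of_row_syzygy (r := r) ?_ ?_)
      · intro i hi
        have : ((M s).updateRow r (A r - B r)).mulVec X i = (M s).mulVec X i := by
          simp only [Matrix.mulVec]
          rw [show (fun j => (M s).updateRow r (A r - B r) i j) = M s i from
            Matrix.updateRow_ne hi]
        rw [this, hM]
        exact hI i
      · have := congrFun hAB r
        simp only [Matrix.mulVec, Matrix.updateRow_self] at this ⊢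
        rw [show (fun j => (A r - B r) j) = A r - B r from rfl, sub_dotProduct]
        exact sub_eq_zero.mpr this
  have : M Finset.univ = A := by funext i; simp [M]
  rw [← this]
  exact key _

end Independence

/-! ### Values of forms on multiples of a point -/

section Scaling

variable {σ K A : Type*} [Field K] [CommRing A] [Algebra K A]

theorem aeval_algebraMap_mul_of_isHomogeneous {φ : MvPolynomial σ K} {m : ℕ}
    (hφ : φ.IsHomogeneous m) (c : σ → K) (y : A) :
    aeval (fun j => algebraMap K A (c j) * y) φ = algebraMap K A (eval c φ) * y ^ m := by
  rw [aeval_def, eval₂_eq, eval_eq, map_sum, Finset.sum_mul]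
  refine Finset.sum_congr rfl fun d hd => ?_
  have hm : ∑ i ∈ d.support, d i = m := (hφ.degree_eq_sum_deg_support hd).symm
  simp only [mul_pow, Finset.prod_mul_distrib, Finset.prod_pow_eq_pow_sum, hm, map_mul,
    map_prod, map_pow, mul_assoc]

theorem eval_smul_of_isHomogeneous {φ : MvPolynomial σ K} {m : ℕ}
    (hφ : φ.IsHomogeneous m) (c : σ → K) (y : K) :
    eval (y • c) φ = y ^ m * eval c φ := by
  have := aeval_algebraMap_mul_of_isHomogeneous (A := K) hφ c y
  rw [mul_comm, ← coe_aeval_eq_eval]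
  have hy : y • c = fun j => algebraMap K K (c j) * y := by
    funext j
    simp [mul_comm]
  rw [hy]
  exact this

end Scaling

/-! ### Forms with and without a common zero -/

section Determinants

variable {σ K : Type*} [Field K]

/-- Modulo the span every X_j becomes c_j X_k, so g becomes g(c) X_k^m = 0. -/
theorem mem_span_sub_of_eval_eq_zero {g : MvPolynomial σ K} {m : ℕ} (hg : g.IsHomogeneous m)
    {c : σ → K} (hc : eval c g = 0) (k : σ) :
    g ∈ Ideal.span (Set.range fun j => X j - C (c j) * X k) := by
  set L := Ideal.span (Set.range fun j => X j - C (c j) * X k) with hL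
  rw [← Ideal.Quotient.eq_zero_iff_mem]
  have h1 : ∀ j, Ideal.Quotient.mk L (X j) = Ideal.Quotient.mk L (C (c j) * X k) := fun j =>
    Ideal.Quotient.eq.mpr (Ideal.subset_span ⟨j, rfl⟩)
  have h2 : ∀ v : σ → MvPolynomial σ K,
      Ideal.Quotient.mk L (aeval v g) = aeval (fun j => Ideal.Quotient.mk L (v j)) g := fun v => by
    have := (comp_aeval_apply v (Ideal.Quotient.mkₐ K L) g)
    simpa using this
  have h3 := aeval_algebraMap_mul_of_isHomogeneous (A := MvPolynomial σ K) hg c (X k)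
  rw [hc, map_zero, zero_mul] at h3
  calc Ideal.Quotient.mk L g = Ideal.Quotient.mk L (aeval X g) := by simp
    _ = Ideal.Quotient.mk L (aeval (fun j => algebraMap K _ (c j) * X k) g) := by
      rw [h2, h2]
      simp only [h1]
      rfl
    _ = 0 := by rw [h3, map_zero]

theorem prod_X_pow_notMem [Fintype σ] (N : ℕ) :
    (∏ i, X i ^ N : MvPolynomial σ K) ∉ Ideal.span (Set.range fun i => X i ^ (N + 1)) := by
  have h1 : (Set.range fun i => X i ^ (N + 1) : Set (MvPolynomial σ K)) =
      (fun s => monomial s 1) '' Set.range fun i : σ => Finsupp.single i (N + 1) := by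
    rw [← Set.range_comp]
    congr 1
    funext i
    simp [X_pow_eq_monomial]
  have h2 : (∏ i, X i ^ N : MvPolynomial σ K) = monomial (∑ i, Finsupp.single i N) 1 := by
    rw [monomial_sum_one]
    simp [X_pow_eq_monomial]
  rw [h1, h2, mem_ideal_span_monomial_image]
  intro h
  obtain ⟨_, ⟨i, rfl⟩, hi⟩ := h (∑ i, Finsupp.single i N) (by
    classical
    rw [mem_support_iff, coeff_monomial, if_pos rfl]
    exact one_ne_zero)
  have := hi i
  simp [Finsupp.finsetSum_apply] at this

variable [Fintype σ] [DecidableEq σ]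

/-- Forms with a common nontrivial zero can be expressed through the variables by a singular
matrix. -/
theorem exists_matrix_det_eq_zero {g : σ → MvPolynomial σ K} {m : ℕ}
    (hg : ∀ i, (g i).IsHomogeneous m) {p : σ → K} (hp : p ≠ 0) (hpg : ∀ i, eval p (g i) = 0) :
    ∃ A : Matrix σ σ (MvPolynomial σ K), A.mulVec X = g ∧ A.det = 0 := by
  obtain ⟨k, hk⟩ := Function.ne_iff.mp hp
  set c : σ → K := (p k)⁻¹ • p with hc
  have hck : c k = 1 := by simpa [hc] using inv_mul_cancel₀ hk
  have hcg : ∀ i, eval c (g i) = 0 := fun i => by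
    rw [hc, eval_smul_of_isHomogeneous (hg i), hpg, mul_zero]
  have h1 := fun i => Ideal.mem_span_range_iff_exists_fun.mp
    (mem_span_sub_of_eval_eq_zero (hg i) (hcg i) k)
  choose a ha using h1
  -- From g_i = ∑ a_ij (X_j − c_j X_k), the X_k terms are gathered in column k. Since c_k = 1, each
  -- row then annihilates c.
  refine ⟨Matrix.of fun i j => a i j - if j = k then ∑ l, a i l * C (c l) else 0, ?_, ?_⟩
  · funext i
    rw [← ha i]
    simp only [Matrix.mulVec, dotProduct, Matrix.of_apply, sub_mul, Finset.sum_sub_distrib, ite_mul,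
      zero_mul, Finset.sum_ite_eq', Finset.mem_univ, if_true, mul_sub, Finset.sum_mul, mul_assoc]
  · rw [← Matrix.exists_mulVec_eq_zero_iff]
    refine ⟨fun j => C (c j), fun h => ?_, ?_⟩
    · have := congrFun h k
      simp [hck] at this
    · funext i
      simp [Matrix.mulVec, dotProduct, sub_mul, hck]

theorem det_mem_span_of_common_zero [CharZero K] {A : Matrix σ σ (MvPolynomial σ K)}
    {g : σ → MvPolynomial σ K} {m : ℕ} (hA : A.mulVec X = g)
    (hg : ∀ i, (g i).IsHomogeneous m) {p : σ → K} (hp : p ≠ 0) (hpg : ∀ i, eval p (g i) = 0) :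
    A.det ∈ Ideal.span (Set.range g) := by
  obtain ⟨B, hB, hB0⟩ := exists_matrix_det_eq_zero hg hp hpg
  have := det_sub_det_mem (I := Ideal.span (Set.range g)) (hA.trans hB.symm)
    (fun i => by rw [hA]; exact Ideal.subset_span ⟨i, rfl⟩)
  rwa [hB0, sub_zero] at this

/-- If the forms `g` generate an ideal containing powers of all the variables, then the determinant
of a matrix expressing `g` through the variables is not in this ideal. -/
theorem det_notMem_span [CharZero K] {A : Matrix σ σ (MvPolynomial σ K)}
    {g : σ → MvPolynomial σ K} (hA : A.mulVec X = g) {N : ℕ}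
    (hN : ∀ i, X i ^ (N + 1) ∈ Ideal.span (Set.range g)) :
    A.det ∉ Ideal.span (Set.range g) := by
  intro hdet
  set Q : Ideal (MvPolynomial σ K) := Ideal.span (Set.range fun i => X i ^ (N + 1)) with hQ
  have h1 := fun i => Ideal.mem_span_range_iff_exists_fun.mp (hN i)
  choose b hb using h1
  let B : Matrix σ σ (MvPolynomial σ K) := Matrix.of b
  have hB : B.mulVec g = fun i => X i ^ (N + 1) := by
    funext i
    rw [← hb i]
    rfl
  -- Both matrices express the powers x_i^(N+1), so their determinants agree modulo Q.
  have hBA : (B * A).mulVec X = (Matrix.diagonal fun i => X i ^ N).mulVec X := by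
    rw [← Matrix.mulVec_mulVec, hA, hB]
    funext i
    rw [Matrix.mulVec_diagonal, pow_succ]
  have h2 := det_sub_det_mem (I := Q) hBA (fun i => by
    rw [← Matrix.mulVec_mulVec, hA, hB]
    exact Ideal.subset_span ⟨i, rfl⟩)
  -- Cramer's rule: det B carries the ideal (g) into Q, so det A ∈ (g) would put ∏ x_i^N in Q.
  have h3 : ∀ i, B.det * g i ∈ Q := by
    intro i
    have : B.det • g = B.adjugate.mulVec (fun i => X i ^ (N + 1)) := by
      rw [← hB, Matrix.mulVec_mulVec, Matrix.adjugate_mul, Matrix.smul_mulVec, Matrix.one_mulVec]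
    have h := congrFun this i
    rw [Pi.smul_apply, smul_eq_mul] at h
    rw [h]
    exact Ideal.sum_mem _ fun j _ => Q.mul_mem_left _ (Ideal.subset_span ⟨j, rfl⟩)
  have h4 : (B * A).det ∈ Q := by
    obtain ⟨c, hc⟩ := Ideal.mem_span_range_iff_exists_fun.mp hdet
    rw [Matrix.det_mul, ← hc, Finset.mul_sum]
    refine Ideal.sum_mem _ fun j _ => ?_
    rw [mul_left_comm]
    exact Q.mul_mem_left _ (h3 j)
  have h5 := Q.sub_mem h4 h2
  rw [sub_sub_cancel, Matrix.det_diagonal] at h5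
  exact prod_X_pow_notMem N h5

end Determinants

/-! ### The Hessian and the Jacobian ideal -/

namespace HessianAlgebra

variable {n d : ℕ} {f : S n}

/-- Euler's relation for ∂_j f, of degree d − 1. With the transpose, symmetry of second derivatives
is not needed. -/
theorem hessianMatrix_transpose_mulVec_X (hf : f.IsHomogeneous d) :
    (hessianMatrix f).transpose.mulVec X = fun j => (d - 1) • pderiv j f := by
  funext j
  rw [← (hf.pderiv (i := j)).sum_X_mul_pderiv]
  simp [Matrix.mulVec, dotProduct, hessianMatrix, mul_comm]

theorem span_nsmul_pderiv_eq (hd : 2 ≤ d) (f : S n) :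
    Ideal.span (Set.range fun j => (d - 1) • pderiv j f) = jacobianIdeal f := by
  have hu : IsUnit ((d - 1 : ℕ) : S n) := by
    rw [← map_natCast (C : ℂ →+* S n)]
    refine IsUnit.map _ (isUnit_iff_ne_zero.mpr ?_)
    exact_mod_cast (by omega : d - 1 ≠ 0)
  apply le_antisymm
  · rw [Ideal.span_le]
    rintro _ ⟨j, rfl⟩
    exact nsmul_mem (Ideal.subset_span (Set.mem_range_self j)) _
  · rw [jacobianIdeal, Ideal.span_le]
    rintro _ ⟨j, rfl⟩
    have : (d - 1) • pderiv j f ∈ Ideal.span (Set.range fun j => (d - 1) • pderiv j f) :=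
      Ideal.subset_span (Set.mem_range_self j)
    rw [nsmul_eq_mul] at this
    exact (Ideal.unit_mul_mem_iff_mem _ hu).mp this

theorem hessian_mem_jacobianIdeal (hd : 2 ≤ d) (hf : f.IsHomogeneous d) (hs : ¬ IsSmooth f) :
    hessian f ∈ jacobianIdeal f := by
  obtain ⟨a, -, ha⟩ := Set.nonempty_iff_ne_empty.mpr hs
  rw [hessian, ← Matrix.det_transpose, ← span_nsmul_pderiv_eq hd]
  refine det_mem_span_of_common_zero (m := d - 1) (hessianMatrix_transpose_mulVec_X hf) (fun i => ?_)
    a.rep_nonzero (fun i => ?_)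
  · exact Submodule.smul_of_tower_mem (homogeneousSubmodule _ ℂ (d - 1)) (d - 1) (hf.pderiv (i := i))
  · rw [map_nsmul, ha, smul_zero]

theorem hessian_notMem_jacobianIdeal (hd : 2 ≤ d) (hf : f.IsHomogeneous d) {N : ℕ}
    (hN : ∀ i, X i ^ (N + 1) ∈ jacobianIdeal f) : hessian f ∉ jacobianIdeal f := by
  rw [hessian, ← Matrix.det_transpose, ← span_nsmul_pderiv_eq hd]
  refine det_notMem_span (hessianMatrix_transpose_mulVec_X hf) (N := N) ?_
  rwa [span_nsmul_pderiv_eq hd]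

/-- The Jacobian ideal of a smooth hypersurface contains powers of all the variables. -/
theorem IsSmooth.exists_X_pow_mem (hd : 2 ≤ d) (hf : f.IsHomogeneous d) (hs : IsSmooth f) :
    ∃ N, ∀ i, X i ^ (N + 1) ∈ jacobianIdeal f := by
  have h1 : ∀ p : Fin (n + 1) → ℂ, (∀ j, eval p (pderiv j f) = 0) → p = 0 := by
    intro p hp
    by_contra hp0
    have hmem : Projectivization.mk ℂ p hp0 ∈ singularPoints f := by
      obtain ⟨u, hu⟩ := Projectivization.exists_smul_eq_mk_rep ℂ p hp0
      have hj : ∀ j, eval (Projectivization.mk ℂ p hp0).rep (pderiv j f) = 0 := fun j => by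
        rw [← hu, Units.smul_def, eval_smul_of_isHomogeneous (hf.pderiv (i := j)), hp, mul_zero]
      -- The vanishing of f itself follows from d·f = ∑ x_j ∂_j f.
      refine ⟨?_, hj⟩
      have h := congrArg (eval (Projectivization.mk ℂ p hp0).rep) hf.sum_X_mul_pderiv
      simp only [map_sum, map_mul, hj, mul_zero, Finset.sum_const_zero, nsmul_eq_mul,
        map_natCast] at h
      have hd0 : (d : ℂ) ≠ 0 := by exact_mod_cast (by omega : d ≠ 0)
      exact (mul_eq_zero.mp h.symm).resolve_left hd0
    rw [hs] at hmem
    exact hmem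
  have h2 : ∀ i, X i ∈ (jacobianIdeal f).radical := by
    intro i
    -- Nullstellensatz: the zero locus of J lies in the origin, where each variable vanishes.
    rw [← vanishingIdeal_zeroLocus_eq_radical (K := ℂ), mem_vanishingIdeal_iff]
    intro p hp
    have : p = 0 := h1 p fun j => by
      rw [mem_zeroLocus_iff] at hp
      have := hp _ (Ideal.subset_span ⟨j, rfl⟩)
      simpa using this
    simp [this]
  choose N hN using h2
  refine ⟨∑ i, N i, fun i => ?_⟩
  refine Ideal.mem_of_dvd _ (pow_dvd_pow _ ?_) (hN i)
  have := Finset.single_le_sum (f := N) (fun _ _ => Nat.zero_le _) (Finset.mem_univ i)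
  omega

end HessianAlgebra

/-! ### Graded pieces and the effect of adding one generator -/

theorem Submodule.finrank_map_add_finrank_inf_ker {K V W : Type*} [Field K] [AddCommGroup V]
    [Module K V] [AddCommGroup W] [Module K W] (p : Submodule K V) [FiniteDimensional K p]
    (f : V →ₗ[K] W) :
    Module.finrank K (p.map f) + Module.finrank K ↥(p ⊓ LinearMap.ker f) = Module.finrank K p := by
  have h := (f.domRestrict p).finrank_range_add_finrank_ker
  rwa [LinearMap.range_domRestrict, LinearMap.ker_domRestrict,
    ← Submodule.finrank_map_subtype_eq, Submodule.map_comap_subtype] at h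

namespace HessianAlgebra

variable {n : ℕ}

/-- The ideal contains the homogeneous components of its elements. -/
def IsGradedIdeal (I : Ideal (S n)) : Prop :=
  ∀ p ∈ I, ∀ m, homogeneousComponent m p ∈ I

attribute [local instance] MvPolynomial.gradedAlgebra in
theorem isGradedIdeal_span {s : Set (S n)} (h : ∀ p ∈ s, ∃ m, p.IsHomogeneous m) :
    IsGradedIdeal (Ideal.span s) := fun _ hp m =>
  homogeneousComponent_mem_of_mem (Ideal.homogeneous_span _ s h) hp m

theorem mem_gradedPiece {I : Ideal (S n)} {m : ℕ} {x : S n ⧸ I} :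
    x ∈ gradedPiece I m ↔ ∃ p : S n, p.IsHomogeneous m ∧ Ideal.Quotient.mk I p = x :=
  Iff.rfl

instance (I : Ideal (S n)) (m : ℕ) : FiniteDimensional ℂ (gradedPiece I m) := by
  have : FiniteDimensional ℂ (homogeneousSubmodule (Fin (n + 1)) ℂ m) :=
    Module.Finite.iff_fg.mpr (homogeneousSubmodule_fg _ _ m)
  unfold gradedPiece
  infer_instance

theorem homogeneousComponent_add_mul {e : ℕ} {a : S n} (ha : a.IsHomogeneous e) (m : ℕ) (q : S n) :
    homogeneousComponent (m + e) (q * a) = homogeneousComponent m q * a := by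
  have h : q * a = ∑ i ∈ Finset.range (q.totalDegree + 1), homogeneousComponent i q * a := by
    rw [← Finset.sum_mul, sum_homogeneousComponent]
  rw [h, map_sum]
  have h2 : ∀ i, homogeneousComponent (m + e) (homogeneousComponent i q * a) =
      if i = m then homogeneousComponent m q * a else 0 := by
    intro i
    rw [homogeneousComponent_of_mem ((homogeneousComponent_isHomogeneous i q).mul ha)]
    by_cases hi : i = m
    · simp [hi]
    · simp [hi, Ne.symm hi]
  simp only [h2, Finset.sum_ite_eq']
  split_ifs with hm
  · rfl
  · rw [homogeneousComponent_eq_zero, zero_mul]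
    simpa using hm

theorem homogeneousComponent_mul_of_lt {e m : ℕ} {a : S n} (ha : a.IsHomogeneous e) (hm : m < e)
    (q : S n) : homogeneousComponent m (q * a) = 0 := by
  have h : q * a = ∑ i ∈ Finset.range (q.totalDegree + 1), homogeneousComponent i q * a := by
    rw [← Finset.sum_mul, sum_homogeneousComponent]
  rw [h, map_sum]
  refine Finset.sum_eq_zero fun i _ => ?_
  rw [homogeneousComponent_of_mem ((homogeneousComponent_isHomogeneous i q).mul ha), if_neg]
  omega

theorem map_factor_gradedPiece {I J : Ideal (S n)} (h : I ≤ J) (m : ℕ) :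
    (gradedPiece I m).map (Ideal.Quotient.factorₐ ℂ h).toLinearMap = gradedPiece J m := by
  unfold gradedPiece
  rw [← Submodule.map_comp]
  congr 1

theorem finrank_gradedPiece_le {I J : Ideal (S n)} (h : I ≤ J) (m : ℕ) :
    Module.finrank ℂ (gradedPiece J m) ≤ Module.finrank ℂ (gradedPiece I m) := by
  rw [← map_factor_gradedPiece h]
  exact Submodule.finrank_map_le _ _

section Step

variable {I : Ideal (S n)} {e : ℕ} {a : S n}

theorem finrank_gradedPiece_sup_of_lt (hI : IsGradedIdeal I) (ha : a.IsHomogeneous e) {m : ℕ}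
    (hm : m < e) : Module.finrank ℂ (gradedPiece (I ⊔ Ideal.span {a}) m) =
      Module.finrank ℂ (gradedPiece I m) := by
  have h := Submodule.finrank_map_add_finrank_inf_ker (gradedPiece I m)
    (Ideal.Quotient.factorₐ ℂ (le_sup_left : I ≤ I ⊔ Ideal.span {a})).toLinearMap
  rw [map_factor_gradedPiece] at h
  rw [← h, left_eq_add, Submodule.finrank_eq_zero, eq_bot_iff]
  rintro x ⟨hx, hx0⟩
  obtain ⟨p, hp, rfl⟩ := mem_gradedPiece.mp hx
  have hp0 : p ∈ I ⊔ Ideal.span {a} := Ideal.Quotient.eq_zero_iff_mem.mp hx0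
  obtain ⟨q, hq, r, hr, rfl⟩ := Submodule.mem_sup.mp hp0
  obtain ⟨s, rfl⟩ := Ideal.mem_span_singleton'.mp hr
  have h1 := homogeneousComponent_eq_self hp
  rw [map_add, homogeneousComponent_mul_of_lt ha hm, add_zero] at h1
  rw [Submodule.mem_bot, Ideal.Quotient.eq_zero_iff_mem, ← h1]
  exact hI q hq m

/-- Multiplication by a maps (S/I)_m to (S/I)_(m+e) with cokernel (S/(I+(a)))_(m+e); k is the
dimension of its kernel. -/
theorem exists_finrank_gradedPiece_sup (hI : IsGradedIdeal I) (ha : a.IsHomogeneous e) (m : ℕ) :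
    ∃ k : ℕ, (k = 0 ↔ ∀ p : S n, p.IsHomogeneous m → p * a ∈ I → p ∈ I) ∧
      Module.finrank ℂ (gradedPiece (I ⊔ Ideal.span {a}) (m + e)) +
        Module.finrank ℂ (gradedPiece I m) = Module.finrank ℂ (gradedPiece I (m + e)) + k := by
  let μ : S n ⧸ I →ₗ[ℂ] S n ⧸ I := LinearMap.mulRight ℂ (Ideal.Quotient.mk I a)
  have h1 := Submodule.finrank_map_add_finrank_inf_ker (gradedPiece I (m + e))
    (Ideal.Quotient.factorₐ ℂ (le_sup_left : I ≤ I ⊔ Ideal.span {a})).toLinearMap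
  have h2 := Submodule.finrank_map_add_finrank_inf_ker (gradedPiece I m) μ
  have h3 : gradedPiece I (m + e) ⊓ LinearMap.ker
      (Ideal.Quotient.factorₐ ℂ (le_sup_left : I ≤ I ⊔ Ideal.span {a})).toLinearMap =
      (gradedPiece I m).map μ := by
    apply le_antisymm
    · rintro x ⟨hx, hx0⟩
      obtain ⟨p, hp, rfl⟩ := mem_gradedPiece.mp hx
      have hp0 : p ∈ I ⊔ Ideal.span {a} := Ideal.Quotient.eq_zero_iff_mem.mp hx0
      obtain ⟨q, hq, r, hr, rfl⟩ := Submodule.mem_sup.mp hp0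
      obtain ⟨s, rfl⟩ := Ideal.mem_span_singleton'.mp hr
      have h1 := homogeneousComponent_eq_self hp
      rw [map_add, homogeneousComponent_add_mul ha] at h1
      refine ⟨Ideal.Quotient.mk I (homogeneousComponent m s),
        mem_gradedPiece.mpr ⟨_, homogeneousComponent_isHomogeneous m s, rfl⟩, ?_⟩
      rw [← h1]
      change Ideal.Quotient.mk I _ * Ideal.Quotient.mk I a = _
      rw [map_add, Ideal.Quotient.eq_zero_iff_mem.mpr (hI q hq _), zero_add, map_mul]
    · rintro _ ⟨x, hx, rfl⟩
      obtain ⟨p, hp, rfl⟩ := mem_gradedPiece.mp hx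
      refine ⟨mem_gradedPiece.mpr ⟨p * a, hp.mul ha, map_mul _ _ _⟩, ?_⟩
      change Ideal.Quotient.mk (I ⊔ Ideal.span {a}) (p * a) = 0
      rw [Ideal.Quotient.eq_zero_iff_mem]
      exact Ideal.mem_sup_right (Ideal.mul_mem_left _ _ (Ideal.mem_span_singleton_self a))
  rw [map_factor_gradedPiece, h3] at h1
  have hfin : FiniteDimensional ℂ ↥(gradedPiece I m ⊓ LinearMap.ker μ) :=
    Submodule.finiteDimensional_of_le (inf_le_left : _ ≤ gradedPiece I m)
  refine ⟨Module.finrank ℂ ↥(gradedPiece I m ⊓ LinearMap.ker μ), ?_, by omega⟩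
  rw [Submodule.finrank_eq_zero, eq_bot_iff]
  have hμ : ∀ p : S n, μ (Ideal.Quotient.mk I p) = 0 ↔ p * a ∈ I := fun p => by
    rw [← Ideal.Quotient.eq_zero_iff_mem, map_mul]; rfl
  constructor
  · intro h p hp hpa
    have := h ⟨mem_gradedPiece.mpr ⟨p, hp, rfl⟩, (hμ p).mpr hpa⟩
    exact Ideal.Quotient.eq_zero_iff_mem.mp this
  · rintro h x ⟨hx, hx0⟩
    obtain ⟨p, hp, rfl⟩ := mem_gradedPiece.mp hx
    exact Ideal.Quotient.eq_zero_iff_mem.mpr (h p hp ((hμ p).mp hx0))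

/-- Comparison of the Hilbert series of `S / I` and `S / (I + (a))`; the correction term counts the
annihilator of `a`. -/
theorem exists_hilbertSeries_sup (hI : IsGradedIdeal I) (ha : a.IsHomogeneous e) :
    ∃ k : ℕ → ℕ, (∀ m, k m = 0 ↔ ∀ p : S n, p.IsHomogeneous m → p * a ∈ I → p ∈ I) ∧
      hilbertSeries (I ⊔ Ideal.span {a}) = (1 - PowerSeries.X ^ e) * hilbertSeries I +
        PowerSeries.X ^ e * PowerSeries.mk fun m => (k m : ℚ) := by
  choose k hk1 hk2 using exists_finrank_gradedPiece_sup hI ha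
  refine ⟨k, hk1, ?_⟩
  ext m
  rw [sub_mul, one_mul, map_add, map_sub, PowerSeries.coeff_X_pow_mul', PowerSeries.coeff_X_pow_mul']
  by_cases hm : e ≤ m
  · obtain ⟨m, rfl⟩ := Nat.exists_eq_add_of_le' hm
    simp only [hilbertSeries, PowerSeries.coeff_mk, hm, if_true, Nat.add_sub_cancel]
    have := hk2 m
    have h : (Module.finrank ℂ (gradedPiece (I ⊔ Ideal.span {a}) (m + e)) : ℚ) +
      Module.finrank ℂ (gradedPiece I m) = Module.finrank ℂ (gradedPiece I (m + e)) + k m := by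
      exact_mod_cast this
    linarith
  · simp only [hilbertSeries, PowerSeries.coeff_mk, hm, if_false, sub_zero, add_zero]
    rw [finrank_gradedPiece_sup_of_lt hI ha (not_le.mp hm)]

end Step

end HessianAlgebra

/-! ### Power series with nonnegative coefficients -/

namespace PowerSeries

/-- All coefficients are nonnegative. -/
def IsNonneg (φ : PowerSeries ℚ) : Prop := ∀ m, 0 ≤ coeff m φ

theorem IsNonneg.add {φ ψ : PowerSeries ℚ} (hφ : φ.IsNonneg) (hψ : ψ.IsNonneg) :
    (φ + ψ).IsNonneg := fun m => by
  rw [map_add]; exact add_nonneg (hφ m) (hψ m)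

theorem IsNonneg.mul {φ ψ : PowerSeries ℚ} (hφ : φ.IsNonneg) (hψ : ψ.IsNonneg) :
    (φ * ψ).IsNonneg := fun m => by
  rw [coeff_mul]; exact Finset.sum_nonneg fun x _ => mul_nonneg (hφ _) (hψ _)

theorem IsNonneg.X_pow (e : ℕ) : (X ^ e : PowerSeries ℚ).IsNonneg := fun m => by
  rw [coeff_X_pow]; split_ifs <;> norm_num

theorem IsNonneg.pow {φ : PowerSeries ℚ} (hφ : φ.IsNonneg) (k : ℕ) : (φ ^ k).IsNonneg := by
  induction k with
  | zero => simpa using IsNonneg.X_pow 0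
  | succ k ih => rw [pow_succ]; exact ih.mul hφ

theorem one_sub_X_pow_mul_inv {e : ℕ} (he : e ≠ 0) :
    (1 - X ^ e : PowerSeries ℚ) * (1 - X ^ e)⁻¹ = 1 :=
  PowerSeries.mul_inv_cancel _ (by simp [he])

theorem isNonneg_inv_one_sub_X_pow {e : ℕ} (he : e ≠ 0) :
    ((1 - X ^ e)⁻¹ : PowerSeries ℚ).IsNonneg := by
  -- This recursion determines the coefficient of degree m from the one of degree m − e.
  have h : ((1 - X ^ e)⁻¹ : PowerSeries ℚ) = 1 + X ^ e * (1 - X ^ e)⁻¹ := by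
    linear_combination one_sub_X_pow_mul_inv he
  intro m
  induction m using Nat.strong_induction_on with
  | _ m ih =>
    rw [h, map_add, coeff_X_pow_mul', coeff_one]
    refine add_nonneg (by split_ifs <;> norm_num) ?_
    split_ifs with hm
    · exact ih _ (by omega)
    · exact le_rfl

end PowerSeries

/-! ### Complete intersection Hilbert series and exchange of generators -/

namespace HessianAlgebra

variable {n e : ℕ}

theorem span_image_insert {ι : Type*} [DecidableEq ι] (g : ι → S n) (s : Finset ι) (i : ι) :
    Ideal.span (g '' ↑(insert i s)) = Ideal.span (g '' ↑s) ⊔ Ideal.span {g i} := by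
  rw [Finset.coe_insert, Set.image_insert_eq, Ideal.span_insert, sup_comm]

theorem isGradedIdeal_span_image {ι : Type*} {g : ι → S n} (hg : ∀ i, (g i).IsHomogeneous e)
    (s : Set ι) : IsGradedIdeal (Ideal.span (g '' s)) := by
  apply isGradedIdeal_span
  rintro _ ⟨i, -, rfl⟩
  exact ⟨e, hg i⟩

theorem isGradedIdeal_span_range {ι : Type*} {g : ι → S n} (hg : ∀ i, (g i).IsHomogeneous e) :
    IsGradedIdeal (Ideal.span (Set.range g)) := by
  rw [← Set.image_univ]
  exact isGradedIdeal_span_image hg _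

/-- Each new generator multiplies the series by 1 − t^e and adds a nonnegative correction.
Multiplying by powers of (1 − t^e)⁻¹, which has nonnegative coefficients, keeps the correction
nonnegative. -/
theorem isNonneg_hilbertSeries_span_sub (he : e ≠ 0) {ι : Type*} {g : ι → S n}
    (hg : ∀ i, (g i).IsHomogeneous e) (s : Finset ι) :
    (hilbertSeries (Ideal.span (g '' ↑s)) * ((1 - PowerSeries.X ^ e)⁻¹) ^ s.card -
      hilbertSeries (⊥ : Ideal (S n))).IsNonneg := by
  classical
  induction s using Finset.induction_on with
  | empty => intro m; simp
  | insert i s hi ih =>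
    obtain ⟨k, -, hk⟩ := exists_hilbertSeries_sup
      (isGradedIdeal_span_image hg (s : Set ι)) (hg i)
    rw [span_image_insert, hk, Finset.card_insert_of_notMem hi]
    have hu := PowerSeries.isNonneg_inv_one_sub_X_pow he
    have hK : (PowerSeries.mk fun m => (k m : ℚ)).IsNonneg := fun m => by simp
    convert ih.add (((PowerSeries.IsNonneg.X_pow e).mul hK).mul (hu.pow (s.card + 1))) using 1
    linear_combination (hilbertSeries (Ideal.span (g '' ↑s)) *
      ((1 - PowerSeries.X ^ e)⁻¹) ^ s.card) * PowerSeries.one_sub_X_pow_mul_inv he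

/-- The Hilbert series of `S / I` is that of a complete intersection of `n + 1` forms of
degree `e`. -/
def HasCIHilbertSeries (e : ℕ) (I : Ideal (S n)) : Prop :=
  hilbertSeries I = (1 - PowerSeries.X ^ e) ^ (n + 1) * hilbertSeries (⊥ : Ideal (S n))

/-- If the Hilbert series of `n + 1` forms is that of a complete intersection, then each form is a
nonzerodivisor modulo the other ones. -/
theorem HasCIHilbertSeries.mem_of_mul_mem (he : e ≠ 0) {g : Fin (n + 1) → S n}
    (hg : ∀ i, (g i).IsHomogeneous e) (i : Fin (n + 1))
    (h : HasCIHilbertSeries e (Ideal.span (Set.range g))) {p : S n} {m : ℕ}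
    (hp : p.IsHomogeneous m) (hpg : p * g i ∈ Ideal.span (g '' ↑(Finset.univ.erase i))) :
    p ∈ Ideal.span (g '' ↑(Finset.univ.erase i)) := by
  obtain ⟨k, hk0, hk⟩ := exists_hilbertSeries_sup
    (isGradedIdeal_span_image hg ((Finset.univ.erase i : Finset _) : Set (Fin (n + 1)))) (hg i)
  refine (hk0 m).mp ?_ p hp hpg
  rw [← span_image_insert, Finset.insert_erase (Finset.mem_univ i), Finset.coe_univ,
    Set.image_univ, h] at hk
  set u : PowerSeries ℚ := (1 - PowerSeries.X ^ e)⁻¹ with hu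
  have hu1 : (1 - PowerSeries.X ^ e) * u = 1 := PowerSeries.one_sub_X_pow_mul_inv he
  have hun : u.IsNonneg := PowerSeries.isNonneg_inv_one_sub_X_pow he
  have hu2 : (1 - PowerSeries.X ^ e) ^ (n + 1) * u ^ (n + 1) = 1 := by
    rw [← mul_pow, hu1, one_pow]
  have h1 := isNonneg_hilbertSeries_span_sub he hg (Finset.univ.erase i)
  have hcard : (Finset.univ.erase i).card = n := by simp
  rw [hcard] at h1
  -- The difference attached to the other n generators is nonnegative, yet the complete intersection
  -- series makes it −t^e k u^(n+1). Since u^(n+1) is nonnegative with constant term 1, every k m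
  -- must vanish.
  have h2 : hilbertSeries (Ideal.span (g '' ↑(Finset.univ.erase i))) * u ^ n -
      hilbertSeries (⊥ : Ideal (S n)) =
      -(PowerSeries.X ^ e * ((PowerSeries.mk fun m => (k m : ℚ)) * u ^ (n + 1))) := by
    linear_combination (-u ^ (n + 1)) * hk - (hilbertSeries (Ideal.span
      (g '' ↑(Finset.univ.erase i))) * u ^ n) * hu1 + hilbertSeries (⊥ : Ideal (S n)) * hu2
  rw [h2] at h1
  have h3 := h1 (m + e)
  rw [map_neg, PowerSeries.coeff_X_pow_mul', if_pos (Nat.le_add_left _ _),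
    Nat.add_sub_cancel, PowerSeries.coeff_mul] at h3
  have h4 := Finset.single_le_sum (f := fun x : ℕ × ℕ =>
    PowerSeries.coeff x.1 (PowerSeries.mk fun m => (k m : ℚ)) * PowerSeries.coeff x.2 (u ^ (n + 1)))
    (s := Finset.HasAntidiagonal.antidiagonal m)
    (fun x _ => mul_nonneg (by simp) (hun.pow _ _)) (a := (m, 0)) (by simp)
  have h5 : PowerSeries.coeff 0 (u ^ (n + 1)) = 1 := by
    simp [hu, PowerSeries.constantCoeff_inv, he]
  simp only [h5, PowerSeries.coeff_mk, mul_one] at h4 h3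
  have h6 : (k m : ℚ) ≤ 0 := by linarith
  exact_mod_cast le_antisymm h6 (Nat.cast_nonneg _)

theorem mem_pow_idealOfVars_of_isHomogeneous {p : S n} {m D : ℕ} (hp : p.IsHomogeneous m)
    (hm : D ≤ m) : p ∈ idealOfVars (Fin (n + 1)) ℂ ^ D := by
  rw [mem_pow_idealOfVars_iff']
  intro x hx
  refine hp.coeff_eq_zero (ne_of_lt (lt_of_lt_of_le hx hm))

/-- Let I be generated by the g_j with j ≠ i. Then g_i is a nonzerodivisor on homogeneous classes
modulo I, and g_i^D ∈ I + (b). Thus p b ∈ I implies p g_i^D ∈ I and p ∈ I, so b is one too and both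
series equal (1 − t^e) HP(S/I). -/
theorem HasCIHilbertSeries.update (he : e ≠ 0) {g : Fin (n + 1) → S n}
    (hg : ∀ i, (g i).IsHomogeneous e) (i : Fin (n + 1)) {b : S n} (hb : b.IsHomogeneous e)
    (h : HasCIHilbertSeries e (Ideal.span (Set.range g))) {D : ℕ}
    (hD : idealOfVars (Fin (n + 1)) ℂ ^ D ≤ Ideal.span (Set.range (Function.update g i b))) :
    HasCIHilbertSeries e (Ideal.span (Set.range (Function.update g i b))) := by
  set I := Ideal.span (g '' ↑(Finset.univ.erase i)) with hI
  have hgr : IsGradedIdeal I := isGradedIdeal_span_image hg _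
  have e1 : Ideal.span (Set.range g) = I ⊔ Ideal.span {g i} := by
    rw [hI, ← span_image_insert, Finset.insert_erase (Finset.mem_univ i), Finset.coe_univ,
      Set.image_univ]
  have e2 : Ideal.span (Set.range (Function.update g i b)) = I ⊔ Ideal.span {b} := by
    have := span_image_insert (Function.update g i b) (Finset.univ.erase i) i
    rw [Finset.insert_erase (Finset.mem_univ i), Finset.coe_univ, Set.image_univ,
      Function.update_self] at this
    rw [this, hI]
    congr 2
    apply Set.image_congr
    intro j hj
    exact Function.update_of_ne (by simpa using hj) _ _
  obtain ⟨k, hk0, hk⟩ := exists_hilbertSeries_sup hgr (hg i)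
  obtain ⟨l, hl0, hl⟩ := exists_hilbertSeries_sup hgr hb
  have hnzd : ∀ m (p : S n), p.IsHomogeneous m → p * g i ∈ I → p ∈ I := fun m p hp hpg =>
    h.mem_of_mul_mem he hg i hp hpg
  have hkz : k = 0 := funext fun m => (hk0 m).mpr (hnzd m)
  have hpow : ∀ j m (p : S n), p.IsHomogeneous m → p * g i ^ j ∈ I → p ∈ I := by
    intro j
    induction j with
    | zero => intro m p _ hp; simpa using hp
    | succ j ih =>
      intro m p hp hpg
      rw [pow_succ, ← mul_assoc] at hpg
      exact ih m p hp (hnzd _ _ (hp.mul ((hg i).pow j)) hpg)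
  have hlz : l = 0 := funext fun m => (hl0 m).mpr fun p hp hpb => by
    have h1 : g i ^ D ∈ I ⊔ Ideal.span {b} := by
      rw [← e2]
      exact hD (mem_pow_idealOfVars_of_isHomogeneous ((hg i).pow D)
        (Nat.le_mul_of_pos_left _ (Nat.pos_of_ne_zero he)))
    obtain ⟨q, hq, r, hr, hqr⟩ := Submodule.mem_sup.mp h1
    obtain ⟨s, rfl⟩ := Ideal.mem_span_singleton'.mp hr
    apply hpow D m p hp
    rw [← hqr, mul_add, mul_left_comm]
    exact I.add_mem (I.mul_mem_left _ hq) (I.mul_mem_left _ hpb)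
  have h1 := h
  rw [HasCIHilbertSeries, e1, hk, hkz, ← hlz, ← hl] at h1
  rw [HasCIHilbertSeries, e2, h1]

end HessianAlgebra

/-! ### The model ideal of pure powers and the Hilbert series of S -/

namespace HessianAlgebra

variable {n e : ℕ}

theorem span_X_pow_image_eq (e : ℕ) (s : Set (Fin (n + 1))) :
    Ideal.span ((fun i => X i ^ e : Fin (n + 1) → S n) '' s) =
      Ideal.span ((fun v => monomial v (1 : ℂ)) '' ((fun i => Finsupp.single i e) '' s)) := by
  rw [Set.image_image]
  simp only [X_pow_eq_monomial]

/-- Multiplying a monomial by x_i^e leaves its exponents in the variables of s unchanged. -/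
theorem mem_span_X_pow_of_mul_mem {s : Set (Fin (n + 1))} {i : Fin (n + 1)} (hi : i ∉ s)
    {p : S n} (hp : p * X i ^ e ∈ Ideal.span ((fun i => X i ^ e : Fin (n + 1) → S n) '' s)) :
    p ∈ Ideal.span ((fun i => X i ^ e : Fin (n + 1) → S n) '' s) := by
  rw [span_X_pow_image_eq, mem_ideal_span_monomial_image] at hp ⊢
  intro v hv
  obtain ⟨_, ⟨j, hj, rfl⟩, hle⟩ := hp (v + Finsupp.single i e) (by
    rw [mem_support_iff, X_pow_eq_monomial, coeff_mul_monomial, mul_one]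
    exact mem_support_iff.mp hv)
  refine ⟨_, ⟨j, hj, rfl⟩, ?_⟩
  have hij : i ≠ j := fun h => hi (h ▸ hj)
  have := hle j
  simpa [Finsupp.single_le_iff, Finsupp.single_apply, hij] using this

theorem hilbertSeries_span_X_pow (e : ℕ) (s : Finset (Fin (n + 1))) :
    hilbertSeries (Ideal.span ((fun i => X i ^ e : Fin (n + 1) → S n) '' ↑s)) =
      (1 - PowerSeries.X ^ e) ^ s.card * hilbertSeries (⊥ : Ideal (S n)) := by
  have hhom : ∀ i, (X i ^ e : S n).IsHomogeneous e := fun i => isHomogeneous_X_pow i e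
  induction s using Finset.induction_on with
  | empty => simp
  | insert i s hi ih =>
    obtain ⟨k, hk0, hk⟩ := exists_hilbertSeries_sup (isGradedIdeal_span_image hhom _) (hhom i)
    have hkz : k = 0 := funext fun m => (hk0 m).mpr fun p _ hpa => mem_span_X_pow_of_mul_mem hi hpa
    rw [span_image_insert, hk, hkz, ih, Finset.card_insert_of_notMem hi]
    have : (PowerSeries.mk fun m => (((0 : ℕ → ℕ) m : ℕ) : ℚ)) = 0 := by ext; simp
    rw [this]
    ring

theorem hasCIHilbertSeries_X_pow (e : ℕ) :
    HasCIHilbertSeries e (Ideal.span (Set.range fun i => X i ^ e : Set (S n))) := by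
  have := hilbertSeries_span_X_pow (n := n) e Finset.univ
  rwa [Finset.coe_univ, Set.image_univ, Finset.card_univ, Fintype.card_fin] at this

theorem hilbertSeries_idealOfVars : hilbertSeries (idealOfVars (Fin (n + 1)) ℂ) = 1 := by
  ext m
  rw [hilbertSeries, PowerSeries.coeff_mk, PowerSeries.coeff_one]
  split_ifs with hm
  · subst hm
    have h1 : gradedPiece (idealOfVars (Fin (n + 1)) ℂ) 0 = Submodule.span ℂ {1} := by
      apply le_antisymm
      · intro x hx
        obtain ⟨p, hp, rfl⟩ := mem_gradedPiece.mp hx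
        rw [← mem_homogeneousSubmodule, homogeneousSubmodule_zero] at hp
        obtain ⟨c, rfl⟩ := Submodule.mem_one.mp hp
        exact Submodule.mem_span_singleton.mpr ⟨c, (Algebra.algebraMap_eq_smul_one c).symm⟩
      · rw [Submodule.span_singleton_le_iff_mem]
        exact mem_gradedPiece.mpr ⟨1, isHomogeneous_one _ _, map_one _⟩
    have h2 : (1 : S n ⧸ idealOfVars (Fin (n + 1)) ℂ) ≠ 0 := by
      have h := C_mem_pow_idealOfVars_iff (σ := Fin (n + 1)) 1 (1 : ℂ)
      rw [pow_one] at h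
      rw [← map_one (Ideal.Quotient.mk _), Ne, Ideal.Quotient.eq_zero_iff_mem, ← C_1, h]
      simp
    rw [h1, finrank_span_singleton h2, Nat.cast_one]
  · rw [Nat.cast_eq_zero, Submodule.finrank_eq_zero, eq_bot_iff]
    intro x hx
    obtain ⟨p, hp, rfl⟩ := mem_gradedPiece.mp hx
    rw [Submodule.mem_bot, Ideal.Quotient.eq_zero_iff_mem, ← pow_one (idealOfVars _ _)]
    exact mem_pow_idealOfVars_of_isHomogeneous hp (Nat.one_le_iff_ne_zero.mpr hm)

/-- The case e = 1 of the pure powers: S/(x_0,…,x_n) = ℂ has series 1, so (1 − t)^(n+1) HP(S) = 1.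
-/
theorem hilbertSeries_bot :
    hilbertSeries (⊥ : Ideal (S n)) = ((1 - PowerSeries.X) ^ (n + 1))⁻¹ := by
  have h := hasCIHilbertSeries_X_pow (n := n) 1
  simp only [HasCIHilbertSeries, pow_one] at h
  have h2 : hilbertSeries (Ideal.span (Set.range fun i => X i : Set (S n))) = 1 :=
    hilbertSeries_idealOfVars
  rw [h2] at h
  rw [PowerSeries.eq_inv_iff_mul_eq_one (by simp), mul_comm]
  exact h.symm

end HessianAlgebra

/-! ### Deformation to pure powers -/

theorem Module.End.finite_setOf_not_surjective_id_add_smul {K V : Type*} [Field K] [AddCommGroup V] [Module K V]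
    [FiniteDimensional K V] (φ : V →ₗ[K] V) :
    {t : K | ¬ Function.Surjective (LinearMap.id + t • φ : V →ₗ[K] V)}.Finite := by
  have h := Module.End.finite_hasEigenvalue (f := φ)
  -- If id + tφ is not injective, then t ≠ 0 and −1/t is one of the finitely many eigenvalues of φ.
  refine (h.preimage (f := fun t : K => -t⁻¹) ?_).subset ?_
  · intro a _ b _ hab
    simpa using hab
  · intro t ht
    rw [Set.mem_ofPred_eq, ← LinearMap.injective_iff_surjective, ← LinearMap.ker_eq_bot] at ht
    obtain ⟨v, hv, hv0⟩ := Submodule.exists_mem_ne_zero_of_ne_bot ht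
    have hv1 : v + t • φ v = 0 := hv
    have ht0 : t ≠ 0 := by
      rintro rfl
      simp [hv0] at hv1
    refine Module.End.hasEigenvalue_of_hasEigenvector (x := v) ⟨?_, hv0⟩
    rw [Module.End.mem_eigenspace_iff]
    have : t • φ v = -v := by rw [eq_neg_iff_add_eq_zero, add_comm, hv1]
    rw [neg_smul, ← smul_neg, ← this, inv_smul_smul₀ ht0]

namespace HessianAlgebra

variable {n e : ℕ}

theorem pow_idealOfVars_le_of_homogeneous {I : Ideal (S n)} {D : ℕ}
    (h : ∀ p : S n, p.IsHomogeneous D → p ∈ I) : idealOfVars (Fin (n + 1)) ℂ ^ D ≤ I := by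
  rw [pow_idealOfVars_eq_span, Ideal.span_le]
  rintro _ ⟨v, hv, rfl⟩
  exact h _ (isHomogeneous_monomial _ hv)

/-- Containing all forms of degree `D` is an open condition on the generators. -/
theorem finite_setOf_not_pow_idealOfVars_le {ι : Type*} [Fintype ι] {g h : ι → S n}
    (hg : ∀ i, (g i).IsHomogeneous e) (hh : ∀ i, (h i).IsHomogeneous e) {D : ℕ}
    (hD : idealOfVars (Fin (n + 1)) ℂ ^ D ≤ Ideal.span (Set.range g)) :
    {t : ℂ | ¬ idealOfVars (Fin (n + 1)) ℂ ^ D ≤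
      Ideal.span (Set.range fun i => g i + C t * h i)}.Finite := by
  set V := homogeneousSubmodule (Fin (n + 1)) ℂ D
  have : FiniteDimensional ℂ V := Module.Finite.iff_fg.mpr (homogeneousSubmodule_fg _ _ D)
  let L : (ι → S n) → (ι → S n) →ₗ[ℂ] S n := fun a =>
    ∑ i, (LinearMap.mulRight ℂ (a i)).comp (LinearMap.proj i)
  have hL : ∀ a q, L a q = ∑ i, q i * a i := fun a q => by simp [L]
  -- A linear choice of coefficients r(p) with p = ∑ r(p)_i g_i for all forms p of degree D.
  obtain ⟨r, hr⟩ : ∃ r : V →ₗ[ℂ] (ι → S n), ∀ p : V, L g (r p) = p := by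
    let P : Submodule ℂ (S n) := (Ideal.span (Set.range g)).restrictScalars ℂ
    have hmem : ∀ q, L g q ∈ P := fun q => by
      rw [hL]
      exact Ideal.sum_mem _ fun i _ => Ideal.mul_mem_left _ _ (Ideal.subset_span ⟨i, rfl⟩)
    have hle : V ≤ P := fun p hp => hD (mem_pow_idealOfVars_of_isHomogeneous hp le_rfl)
    obtain ⟨r, hr⟩ := Module.projective_lifting_property ((L g).codRestrict P hmem)
      (Submodule.inclusion hle) (fun p => by
        obtain ⟨q, hq⟩ := Ideal.mem_span_range_iff_exists_fun.mp p.2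
        exact ⟨q, Subtype.ext (by rw [LinearMap.codRestrict_apply, hL, hq])⟩)
    refine ⟨r, fun p => ?_⟩
    have := congrArg Subtype.val (LinearMap.congr_fun hr p)
    simpa using this
  -- Chosen so that (id + tφ)(p) is the degree D component of ∑ r(p)_i (g_i + t h_i), which lies in
  -- the deformed ideal; surjectivity then suffices.
  let φ : V →ₗ[ℂ] V := ((homogeneousComponent D).codRestrict V
    (homogeneousComponent_mem D)).comp ((L h).comp r)
  refine (Module.End.finite_setOf_not_surjective_id_add_smul φ).subset fun t ht hs => ht ?_
  apply pow_idealOfVars_le_of_homogeneous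
  intro p hp
  obtain ⟨p', hp'⟩ := hs ⟨p, hp⟩
  have h1 : p = homogeneousComponent D (∑ i, r p' i * (g i + C t * h i)) := by
    have h2 : ∑ i, r p' i * (g i + C t * h i) = (p' : S n) + t • L h (r p') := by
      rw [← hr p', hL, hL, Finset.smul_sum, ← Finset.sum_add_distrib]
      refine Finset.sum_congr rfl fun i _ => ?_
      rw [smul_eq_C_mul]
      ring
    rw [h2, map_add, map_smul, homogeneousComponent_eq_self p'.2]
    exact (congrArg Subtype.val hp').symm
  rw [h1]
  refine isGradedIdeal_span_range (e := e) (fun i => (hg i).add ((hh i).C_mul t)) _ ?_ D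
  exact Ideal.sum_mem _ fun i _ => Ideal.mul_mem_left _ _ (Ideal.subset_span ⟨i, rfl⟩)

/-- The first `k` members of the family `g` are replaced by those of `g'`. -/
def replaceInitial (g g' : Fin (n + 1) → S n) (k : ℕ) : Fin (n + 1) → S n :=
  fun i => if i.val < k then g' i else g i

/-- Consecutive families differ in one generator, so the exchange lemma applies in both directions.
-/
theorem hasCIHilbertSeries_iff_of_replaceInitial (he : e ≠ 0) {g g' : Fin (n + 1) → S n}
    (hg : ∀ i, (g i).IsHomogeneous e) (hg' : ∀ i, (g' i).IsHomogeneous e) {D : ℕ}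
    (hD : ∀ k ≤ n + 1, idealOfVars (Fin (n + 1)) ℂ ^ D ≤
      Ideal.span (Set.range (replaceInitial g g' k))) :
    HasCIHilbertSeries e (Ideal.span (Set.range g)) ↔
      HasCIHilbertSeries e (Ideal.span (Set.range g')) := by
  have hhom : ∀ k i, (replaceInitial g g' k i).IsHomogeneous e := fun k i => by
    unfold replaceInitial
    split_ifs
    exacts [hg' i, hg i]
  have key : ∀ k ≤ n + 1, (HasCIHilbertSeries e (Ideal.span (Set.range g)) ↔
      HasCIHilbertSeries e (Ideal.span (Set.range (replaceInitial g g' k)))) := by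
    intro k
    induction k with
    | zero =>
      intro _
      have : replaceInitial g g' 0 = g := by funext i; simp [replaceInitial]
      rw [this]
    | succ k ih =>
      intro hk
      rw [ih (by omega)]
      let i : Fin (n + 1) := ⟨k, by omega⟩
      have e1 : replaceInitial g g' (k + 1) = Function.update (replaceInitial g g' k) i (g' i) := by
        funext j
        by_cases hj : j = i
        · subst hj; simp [replaceInitial, i]
        · have : j.val ≠ k := fun h => hj (Fin.ext h)
          rw [Function.update_of_ne hj]
          have : j.val < k + 1 ↔ j.val < k := by omega
          simp only [replaceInitial, this]
      have e2 : replaceInitial g g' k = Function.update (replaceInitial g g' (k + 1)) i (g i) := by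
        funext j
        by_cases hj : j = i
        · subst hj; simp [replaceInitial, i]
        · rw [e1, Function.update_of_ne hj, Function.update_of_ne hj]
      constructor
      · intro h
        have hd := hD (k + 1) hk
        rw [e1] at hd ⊢
        exact h.update he (hhom k) i (hg' i) hd
      · intro h
        have hd := hD k (by omega)
        rw [e2] at hd ⊢
        exact h.update he (hhom (k + 1)) i (hg i) hd
  rw [key (n + 1) le_rfl]
  have : replaceInitial g g' (n + 1) = g' := by funext i; simp only [replaceInitial, i.isLt, if_true]
  rw [this]

theorem finite_setOf_not_hasCIHilbertSeries_iff (he : e ≠ 0) {g h : Fin (n + 1) → S n}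
    (hg : ∀ i, (g i).IsHomogeneous e) (hh : ∀ i, (h i).IsHomogeneous e) {D : ℕ}
    (hD : idealOfVars (Fin (n + 1)) ℂ ^ D ≤ Ideal.span (Set.range g)) :
    {t : ℂ | ¬ (HasCIHilbertSeries e (Ideal.span (Set.range g)) ↔
      HasCIHilbertSeries e (Ideal.span (Set.range fun i => g i + C t * h i)))}.Finite := by
  -- The intermediate families between g and g + t h are g + t h_k with h_k truncated to its first k
  -- entries; each excludes finitely many t.
  let hk : ℕ → Fin (n + 1) → S n := fun k i => if i.val < k then h i else 0
  have hhk : ∀ k i, (hk k i).IsHomogeneous e := fun k i => by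
    simp only [hk]
    split_ifs
    exacts [hh i, isHomogeneous_zero _ _ _]
  refine ((Finset.range (n + 2)).finite_toSet.biUnion fun k _ =>
    finite_setOf_not_pow_idealOfVars_le hg (hhk k) hD).subset ?_
  intro t ht
  by_contra hcon
  simp only [Set.mem_iUnion, not_exists, Finset.coe_range, Set.mem_Iio, Set.mem_ofPred_eq,
    not_not] at hcon
  refine ht (hasCIHilbertSeries_iff_of_replaceInitial he hg
    (fun i => (hg i).add ((hh i).C_mul t)) (D := D) fun k hkn => ?_)
  convert hcon k (by omega) using 3
  funext i
  simp only [replaceInitial, hk]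
  split_ifs <;> simp

/-- Forms of degree `e` whose ideal contains all forms of large degree have the Hilbert series of
a complete intersection. -/
theorem hasCIHilbertSeries_of_pow_idealOfVars_le (he : e ≠ 0) {g : Fin (n + 1) → S n}
    (hg : ∀ i, (g i).IsHomogeneous e) {D : ℕ}
    (hD : idealOfVars (Fin (n + 1)) ℂ ^ D ≤ Ideal.span (Set.range g)) :
    HasCIHilbertSeries e (Ideal.span (Set.range g)) := by
  have hX : ∀ i, (X i ^ e : S n).IsHomogeneous e := fun i => isHomogeneous_X_pow i e
  have hDX : idealOfVars (Fin (n + 1)) ℂ ^ ((n + 1) * e) ≤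
      Ideal.span (Set.range fun i => X i ^ e : Set (S n)) := by
    -- Pigeonhole: a monomial of degree (n+1)e in n+1 variables has an exponent at least e.
    rw [pow_idealOfVars_eq_span, Ideal.span_le]
    rintro _ ⟨v, hv, rfl⟩
    obtain ⟨i, hi⟩ : ∃ i, e ≤ v i := by
      by_contra! hlt
      have h1 : v.degree < ∑ _i : Fin (n + 1), e := by
        rw [Finsupp.degree_eq_sum]
        exact Finset.sum_lt_sum_of_nonempty Finset.univ_nonempty fun i _ => hlt i
      have hv' : v.degree = (n + 1) * e := hv
      simp [hv'] at h1
    refine Ideal.mem_of_dvd _ ?_ (Ideal.subset_span (Set.mem_range_self i))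
    simp only [X_pow_eq_monomial]
    exact monomial_dvd_monomial.mpr ⟨Or.inr (by simpa using hi), dvd_rfl⟩
  -- The pencil is entered from both ends: x^e + s g and g + s⁻¹ x^e generate the same ideal, and s
  -- is chosen nonzero and good for both.
  have f1 := finite_setOf_not_hasCIHilbertSeries_iff he hX hg hDX
  have f2 := (finite_setOf_not_hasCIHilbertSeries_iff he hg hX hD).preimage
    (f := fun t : ℂ => t⁻¹) inv_injective.injOn
  obtain ⟨s, hs⟩ := ((f1.union f2).union (Set.finite_singleton (0 : ℂ))).exists_notMem
  simp only [Set.mem_union, Set.mem_ofPred_eq, Set.mem_preimage, not_or, not_not,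
    Set.mem_singleton_iff] at hs
  obtain ⟨⟨h1, h2⟩, hs0⟩ := hs
  rw [h2]
  have : Ideal.span (Set.range fun i => g i + C s⁻¹ * X i ^ e) =
      Ideal.span (Set.range fun i => X i ^ e + C s * g i) := by
    have hC : (C s * C s⁻¹ : S n) = 1 := by rw [← C_mul, mul_inv_cancel₀ hs0, C_1]
    apply le_antisymm
    · rw [Ideal.span_le]
      rintro _ ⟨i, rfl⟩
      have : g i + C s⁻¹ * X i ^ e = C s⁻¹ * (X i ^ e + C s * g i) := by
        linear_combination (-g i) * hC
      simp only [this]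
      exact Ideal.mul_mem_left _ _ (Ideal.subset_span ⟨i, rfl⟩)
    · rw [Ideal.span_le]
      rintro _ ⟨i, rfl⟩
      have : X i ^ e + C s * g i = C s * (g i + C s⁻¹ * X i ^ e) := by
        linear_combination (-X i ^ e) * hC
      simp only [this]
      exact Ideal.mul_mem_left _ _ (Ideal.subset_span ⟨i, rfl⟩)
  rw [this, ← h1]
  exact hasCIHilbertSeries_X_pow e

end HessianAlgebra

/-! ### Hilbert series of the Milnor and Hessian algebras -/

namespace HessianAlgebra

variable {n d : ℕ} {f : S n}

theorem isHomogeneous_hessian (hf : f.IsHomogeneous d) :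
    (hessian f).IsHomogeneous ((n + 1) * (d - 2)) := by
  rw [hessian, Matrix.det_apply]
  refine IsHomogeneous.sum _ _ _ fun τ _ => ?_
  rw [Units.smul_def]
  refine Submodule.smul_of_tower_mem (homogeneousSubmodule _ ℂ _) _ ?_
  have h := IsHomogeneous.prod Finset.univ (fun i => hessianMatrix f (τ i) i) (fun _ => d - 2)
    (fun i _ => by
      have := (hf.pderiv (i := i)).pderiv (i := τ i)
      rwa [Nat.sub_sub] at this)
  simpa using h

theorem hessianMinorIdeal_card_eq (f : S n) :
    hessianMinorIdeal (n + 1) f = Ideal.span {hessian f} := by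
  have h1 : ∀ r : Fin (n + 1) ↪o Fin (n + 1), (r : Fin (n + 1) → Fin (n + 1)) = id := fun r =>
    r.strictMono.eq_id
  have h2 : ∀ rc : (Fin (n + 1) ↪o Fin (n + 1)) × (Fin (n + 1) ↪o Fin (n + 1)),
      ((hessianMatrix f).submatrix rc.1 rc.2).det = hessian f := fun rc => by
    rw [h1, h1, Matrix.submatrix_id_id, hessian]
  rw [hessianMinorIdeal, funext h2, Set.range_const]

theorem HPHessian_card_eq (f : S n) :
    HPHessian (n + 1) f = hilbertSeries (jacobianIdeal f ⊔ Ideal.span {hessian f}) := by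
  rw [HPHessian, hessianMinorIdeal_card_eq]

theorem isGradedIdeal_jacobianIdeal (hf : f.IsHomogeneous d) : IsGradedIdeal (jacobianIdeal f) :=
  isGradedIdeal_span_range fun _ => hf.pderiv

theorem HPMilnor_of_X_pow_mem (hd : 2 ≤ d) (hf : f.IsHomogeneous d) {N : ℕ}
    (hN : ∀ i, X i ^ (N + 1) ∈ jacobianIdeal f) :
    HPMilnor f = (1 - PowerSeries.X ^ (d - 1)) ^ (n + 1) * ((1 - PowerSeries.X) ^ (n + 1))⁻¹ := by
  have hle : idealOfVars (Fin (n + 1)) ℂ ≤ (jacobianIdeal f).radical := by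
    rw [idealOfVars, Ideal.span_le]
    rintro _ ⟨i, rfl⟩
    exact ⟨N + 1, hN i⟩
  obtain ⟨D, hD⟩ := Ideal.exists_pow_le_of_le_radical_of_fg hle (idealOfVars_fg _ _)
  rw [HPMilnor, ← hilbertSeries_bot]
  exact hasCIHilbertSeries_of_pow_idealOfVars_le (by omega) (fun i => hf.pderiv) hD

theorem one_sub_X_pow_pow_mul_inv (e k : ℕ) :
    ((1 - PowerSeries.X ^ e) ^ k * ((1 - PowerSeries.X) ^ k)⁻¹ : PowerSeries ℚ) =
      (((∑ i ∈ Finset.range e, Polynomial.X ^ i) ^ k : Polynomial ℚ) : PowerSeries ℚ) := by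
  have h1 : ((∑ i ∈ Finset.range e, Polynomial.X ^ i : Polynomial ℚ) : PowerSeries ℚ) *
      (1 - PowerSeries.X) = 1 - PowerSeries.X ^ e := by
    have := congrArg (Polynomial.toPowerSeries (R := ℚ))
      (geom_sum_mul_neg (Polynomial.X : Polynomial ℚ) e)
    simpa using this
  have h2 : ((1 - PowerSeries.X) ^ k * ((1 - PowerSeries.X) ^ k)⁻¹ : PowerSeries ℚ) = 1 :=
    PowerSeries.mul_inv_cancel _ (by simp)
  rw [← h1, mul_pow, mul_assoc, h2, mul_one, Polynomial.coe_pow]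

/-- The Milnor algebra has dimension 1 in degree T and 0 above it; the Hessian has degree T and is
nonzero there, so it kills precisely this top piece. -/
theorem HPHessian_of_X_pow_mem (hd : 2 ≤ d) (hf : f.IsHomogeneous d) {N : ℕ}
    (hN : ∀ i, X i ^ (N + 1) ∈ jacobianIdeal f) :
    HPHessian (n + 1) f = HPMilnor f - PowerSeries.X ^ ((n + 1) * (d - 2)) := by
  set T := (n + 1) * (d - 2) with hT
  set P : Polynomial ℚ := (∑ i ∈ Finset.range (d - 1), Polynomial.X ^ i) ^ (n + 1) with hP
  have hHP : HPMilnor f = (P : PowerSeries ℚ) := by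
    rw [HPMilnor_of_X_pow_mem hd hf hN, one_sub_X_pow_pow_mul_inv]
  have hcoeff : ∀ m, (Module.finrank ℂ (gradedPiece (jacobianIdeal f) m) : ℚ) = P.coeff m := by
    intro m
    rw [← Polynomial.coeff_coe, ← hHP, HPMilnor, hilbertSeries, PowerSeries.coeff_mk]
  have hmonic : P.Monic := (Polynomial.monic_geom_sum_X (by omega)).pow _
  have hdeg : P.natDegree = T := by
    rw [hP, Polynomial.natDegree_pow]
    obtain ⟨e, rfl⟩ := Nat.exists_eq_add_of_le' hd
    congr 1
    have h1 : (∑ i ∈ Finset.range (e + 1), Polynomial.X ^ i : Polynomial ℚ) =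
        Polynomial.X ^ e + ∑ i ∈ Finset.range e, Polynomial.X ^ i := by
      rw [Finset.sum_range_succ, add_comm]
    change (∑ i ∈ Finset.range (e + 1), Polynomial.X ^ i : Polynomial ℚ).natDegree = e
    rw [h1]
    compute_degree!
    exact Polynomial.natDegree_sum_le_of_forall_le _ _ fun i hi =>
      (Polynomial.natDegree_X_pow_le i).trans (Finset.mem_range.mp hi).le
  have h0 : Module.finrank ℂ (gradedPiece (jacobianIdeal f) 0) = 1 := by
    have h := hcoeff 0
    have hP0 : P.coeff 0 = 1 := by
      rw [hP, Polynomial.coeff_zero_eq_eval_zero, Polynomial.eval_pow, Polynomial.eval_finsetSum]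
      obtain ⟨e, rfl⟩ := Nat.exists_eq_add_of_le' hd
      change (∑ i ∈ Finset.range (e + 1), Polynomial.eval 0 (Polynomial.X ^ i) : ℚ) ^ (n + 1) = 1
      rw [Finset.sum_range_succ']
      simp
    rw [hP0] at h
    exact_mod_cast h
  have hTop : Module.finrank ℂ (gradedPiece (jacobianIdeal f) T) = 1 := by
    have h := hcoeff T
    rw [← hdeg, hmonic.coeff_natDegree, hdeg] at h
    exact_mod_cast h
  have hlarge : ∀ m, T < m → Module.finrank ℂ (gradedPiece (jacobianIdeal f) m) = 0 := by
    intro m hm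
    have h := hcoeff m
    rw [Polynomial.coeff_eq_zero_of_natDegree_lt (by rwa [hdeg])] at h
    exact_mod_cast h
  have hgr := isGradedIdeal_jacobianIdeal hf
  have hh : (hessian f).IsHomogeneous T := isHomogeneous_hessian hf
  rw [HPHessian_card_eq]
  ext m
  rw [map_sub, PowerSeries.coeff_X_pow, HPMilnor, hilbertSeries, hilbertSeries,
    PowerSeries.coeff_mk, PowerSeries.coeff_mk]
  rcases lt_trichotomy m T with hm | rfl | hm
  · rw [finrank_gradedPiece_sup_of_lt hgr hh hm, if_neg hm.ne, sub_zero]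
  -- Multiplication by the Hessian from degree 0 to degree T is injective because h ∉ J, so it fills
  -- the line M(f)_T.
  · obtain ⟨k, hk0, hk⟩ := exists_finrank_gradedPiece_sup hgr hh 0
    have : k = 0 := hk0.mpr fun p hp hph => by
      rw [← mem_homogeneousSubmodule, homogeneousSubmodule_zero] at hp
      obtain ⟨c, rfl⟩ := Submodule.mem_one.mp hp
      by_cases hc : c = 0
      · simp [hc]
      · exfalso
        refine hessian_notMem_jacobianIdeal hd hf hN ((Ideal.unit_mul_mem_iff_mem _ ?_).mp hph)
        exact (isUnit_iff_ne_zero.mpr hc).map _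
    rw [zero_add, h0, hTop, this] at hk
    rw [hTop, if_pos rfl]
    have : Module.finrank ℂ (gradedPiece (jacobianIdeal f ⊔ Ideal.span {hessian f}) T) = 0 := by
      omega
    rw [this]
    simp
  · have := finrank_gradedPiece_le (le_sup_left : _ ≤ jacobianIdeal f ⊔ Ideal.span {hessian f}) m
    rw [hlarge m hm, Nat.le_zero] at this
    rw [this, hlarge m hm, if_neg hm.ne', sub_zero]

end HessianAlgebra

theorem propositionA (n d : ℕ) (hd : 2 ≤ d) (f : HessianAlgebra.S n) (hf : f.IsHomogeneous d) :
    (HessianAlgebra.IsSmooth f →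
      HessianAlgebra.HPHessian (n + 1) f =
          HessianAlgebra.HPMilnor f - PowerSeries.X ^ ((n + 1) * (d - 2)) ∧
        HessianAlgebra.HPMilnor f =
          (1 - PowerSeries.X ^ (d - 1)) ^ (n + 1) * ((1 - PowerSeries.X) ^ (n + 1))⁻¹) ∧
    (HessianAlgebra.HasIsolatedSingularities f → ¬ HessianAlgebra.IsSmooth f →
      HessianAlgebra.hessian f ∈ HessianAlgebra.jacobianIdeal f ∧
        HessianAlgebra.HPHessian (n + 1) f = HessianAlgebra.HPMilnor f) := by
  constructor
  · intro hs
    obtain ⟨N, hN⟩ := hs.exists_X_pow_mem hd hf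
    exact ⟨HessianAlgebra.HPHessian_of_X_pow_mem hd hf hN,
      HessianAlgebra.HPMilnor_of_X_pow_mem hd hf hN⟩
  · intro _ hs
    have h := HessianAlgebra.hessian_mem_jacobianIdeal hd hf hs
    refine ⟨h, ?_⟩
    rw [HessianAlgebra.HPHessian_card_eq, HessianAlgebra.HPMilnor,
      sup_eq_left.mpr ((Ideal.span_singleton_le_iff_mem _).mpr h)]
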